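/- Let $S_1,S_2$ be finite sets (the pure strategies of two agents) and let $A=(A_{ab})_{a\in S_1,\,b\in S_2}$ be a real matrix whose entries are pairwise distinct. Consider the two-agent zero-sum game in which agent 1 has payoff matrix $A$ and agent 2 has payoff matrix $-A^{\top}$. Let $\Delta(S_i)$ be the simplex of probability vectors on $S_i$ and let $\mathcal X=\Delta(S_1)\times\Delta(S_2)$, with its Borel $\sigma$-algebra. Let $\eta_1,\eta_2>0$ be learning rates. For $s=(s_1,s_2)\in S_1\times S_2$ and $x=(x_1,x_2)\in\mathcal X$ let $R(s,x)\in\mathcal X$ be the multiplicative weights update of $x$ after the pure strategies $s$ have been realized: $$R_1(s,x)_a=\frac{x_{1a}\,e^{\eta_1A_{a s_2}}}{\sum_{a'\in S_1}x_{1a'}\,e^{\eta_1A_{a's_2}}}\quad(a\in S_1),\qquad R_2(s,x)_b=\frac{x_{2b}\,e^{-\eta_2A_{s_1b}}}{\sum_{b'\in S_2}x_{2b'}\,e^{-\eta_2A_{s_1b'}}}\quad(b\in S_2).$$ The primal-space chain of stochastic multiplicative weights is the Markov chain on $\mathcal X$ with transition kernel $$P(x,B)=\sum_{s\in S_1\times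 S_2:\ R(s,x)\in B}x_{1s_1}x_{2s_2}\qquad(x\in\mathcal X,\ B\subseteq\mathcal X\text{ Borel}),$$ that is, the pure strategies $s_1,s_2$ are drawn independently from $x_1,x_2$ and $x$ moves to $R(s,x)$. Then a Borel probability measure $\pi$ on $\mathcal X$ is stationary for this chain, i.e. $\int_{\mathcal X}P(x,B)\,\pi(dx)=\pi(B)$ for every Borel set $B$, if and only if $\pi$ is concentrated on the pure strategy profiles, i.e. $\pi\bigl(\mathcal X\setminus\{(e_{s_1},e_{s_2}):s_1\in S_1,\ s_2\in S_2\}\bigr)=0$, where $e_{s_i}$ denotes the standard basis vector (point mass) at $s_i$. -/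

import Mathlib

open MeasureTheory ProbabilityTheory

noncomputable section

namespace StochasticMWU

variable {S S₁ S₂ : Type*} [Fintype S] [Fintype S₁] [Fintype S₂]

/-- Mixed strategy profiles of a two-agent game with finite action sets `S₁` and `S₂`:
pairs of probability vectors, with the subspace topology and its Borel sigma-algebra. -/
abbrev Profile (S₁ S₂ : Type*) [Fintype S₁] [Fintype S₂] : Type _ :=
  stdSimplex ℝ S₁ × stdSimplex ℝ S₂

/-- The normalizing constant of a multiplicative weights update is positive. -/
theorem mwu_denom_pos (η : ℝ) (u : S → ℝ) (x : stdSimplex ℝ S) :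
    0 < ∑ b, x b * Real.exp (η * u b) := by
  have hx0 := x.2.1
  have hx1 : ∑ b, x b = 1 := x.2.2
  have hnn : ∀ b ∈ Finset.univ, 0 ≤ x b * Real.exp (η * u b) :=
    fun b _ => mul_nonneg (hx0 b) (Real.exp_pos _).le
  refine lt_of_le_of_ne (Finset.sum_nonneg hnn) fun h => ?_
  have h0 := (Finset.sum_eq_zero_iff_of_nonneg hnn).1 h.symm
  have hz : ∀ b, x b = 0 := fun b =>
    (mul_eq_zero.1 (h0 b (Finset.mem_univ b))).resolve_right (Real.exp_pos _).ne'
  simp only [hz, Finset.sum_const_zero] at hx1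
  exact zero_ne_one hx1

/-- The multiplicative weights update of a mixed strategy `x`, with learning rate `η`, after the
payoff vector `u` has been observed:
`a ↦ x a * exp (η * u a) / ∑ b, x b * exp (η * u b)`. -/
def mwu (η : ℝ) (u : S → ℝ) (x : stdSimplex ℝ S) : stdSimplex ℝ S :=
  ⟨fun a => x a * Real.exp (η * u a) / ∑ b, x b * Real.exp (η * u b),
    fun a => div_nonneg (mul_nonneg (x.2.1 a) (Real.exp_pos _).le) (mwu_denom_pos η u x).le, by
      rw [← Finset.sum_div]
      exact div_self (mwu_denom_pos η u x).ne'⟩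

theorem measurable_mwu (η : ℝ) (u : S → ℝ) : Measurable (mwu η u) := by
  refine Measurable.subtype_mk (measurable_pi_lambda _ fun a => ?_)
  have h : ∀ b, Measurable fun x : stdSimplex ℝ S => x b :=
    fun b => (measurable_pi_apply b).comp measurable_subtype_coe
  exact ((h a).mul_const _).div (Finset.measurable_sum _ fun b _ => (h b).mul_const _)

/-- The profile that follows `x` when the pure strategies `s = (s₁, s₂)` are realized in the
two-agent zero-sum game with payoff matrix `A` for agent 1 and `-Aᵀ` for agent 2, the agents using
the learning rates `η₁` and `η₂`. Agent 1 observes the payoffs `A a s₂`, and agent 2 the payoffs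
`(-Aᵀ) b s₁`. -/
def step (A : Matrix S₁ S₂ ℝ) (η₁ η₂ : ℝ) (s : S₁ × S₂) (x : Profile S₁ S₂) : Profile S₁ S₂ :=
  (mwu η₁ (fun a => A a s.2) x.1, mwu η₂ (fun b => (-A.transpose) b s.1) x.2)

theorem measurable_step (A : Matrix S₁ S₂ ℝ) (η₁ η₂ : ℝ) (s : S₁ × S₂) :
    Measurable (step A η₁ η₂ s) :=
  ((measurable_mwu _ _).comp measurable_fst).prodMk ((measurable_mwu _ _).comp measurable_snd)

/-- The probability that the pure strategies `s = (s₁, s₂)` are realized when the agents draw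
them independently from the mixed strategies `x = (x₁, x₂)`. -/
def playProb (x : Profile S₁ S₂) (s : S₁ × S₂) : ℝ :=
  x.1 s.1 * x.2 s.2

theorem measurable_playProb (s : S₁ × S₂) :
    Measurable fun x : Profile S₁ S₂ => playProb x s :=
  (((measurable_pi_apply s.1).comp measurable_subtype_coe).comp measurable_fst).mul
    (((measurable_pi_apply s.2).comp measurable_subtype_coe).comp measurable_snd)

/-- The transition kernel of stochastic multiplicative weights in the space of mixed strategy
profiles: from `x`, the next profile is `step A η₁ η₂ s x` with `s` drawn from `x₁ ⊗ x₂`. Thus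
`P(x, {z})` is the sum of `x₁(s₁) * x₂(s₂)` over all `s` with `step A η₁ η₂ s x = z`. -/
def kernel (A : Matrix S₁ S₂ ℝ) (η₁ η₂ : ℝ) : Kernel (Profile S₁ S₂) (Profile S₁ S₂) where
  toFun x := ∑ s : S₁ × S₂, ENNReal.ofReal (playProb x s) • Measure.dirac (step A η₁ η₂ s x)
  measurable' := by
    refine Measure.measurable_of_measurable_coe _ fun B hB => ?_
    simp only [Measure.coe_finsetSum, Finset.sum_apply, Measure.smul_apply, smul_eq_mul]
    refine Finset.measurable_sum _ fun s _ => (measurable_playProb s).ennreal_ofReal.mul ?_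
    exact (Measure.measurable_coe hB).comp
      (Measure.measurable_dirac.comp (measurable_step A η₁ η₂ s))

/-- The transition kernel is Markov: each `P(x, ·)` is a probability measure. -/
instance (A : Matrix S₁ S₂ ℝ) (η₁ η₂ : ℝ) : IsMarkovKernel (kernel A η₁ η₂) where
  isProbabilityMeasure x := by
    constructor
    have hnn : ∀ s ∈ Finset.univ, 0 ≤ playProb x s :=
      fun s _ => mul_nonneg (x.1.2.1 s.1) (x.2.2.1 s.2)
    have hsum : ∑ s, playProb x s = 1 := by
      have h1 : ∑ a, x.1 a = 1 := x.1.2.2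
      have h2 : ∑ b, x.2 b = 1 := x.2.2.2
      simp only [playProb, Fintype.sum_prod_type, ← Finset.mul_sum, h2, mul_one, h1]
    change (∑ s, ENNReal.ofReal (playProb x s) • Measure.dirac (step A η₁ η₂ s x)) Set.univ = 1
    simp only [Measure.coe_finsetSum, Finset.sum_apply, Measure.smul_apply, smul_eq_mul,
      measure_univ, mul_one]
    rw [← ENNReal.ofReal_sum_of_nonneg hnn, hsum, ENNReal.ofReal_one]

open Classical in
/-- The pure strategy profiles: pairs `(e_{s₁}, e_{s₂})` of standard basis vectors. -/
def pureProfiles (S₁ S₂ : Type*) [Fintype S₁] [Fintype S₂] : Set (Profile S₁ S₂) :=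
  Set.range fun s : S₁ × S₂ => (stdSimplex.vertex s.1, stdSimplex.vertex s.2)

end StochasticMWU

end

/-! Updates preserve supports, so a stationary law can be studied on each relatively open face
separately. There `log (x.1 a)`, for `a` in the support, has increment `η₁ * A a s₂` minus a
log-partition term independent of `a`. Its mean drift under `π` vanishes although the logarithm need
not be integrable (`integral_drift_eq_zero`). Hence all supported actions earn the same payoff
against the opponent's mean strategy (`mean_payoff_fst`, `mean_payoff_snd`).

Averaging these identities over each agent's own mean strategy, the zero-sum property cancels both
payoffs, so `excess` has integral zero on every face. Pointwise, zero sum also turns `excess` into a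
weighted sum of Jensen gaps, hence it is nonnegative and vanishes almost everywhere. Equality in
Jensen forces constant payoffs on the support, and distinct entries leave only pure profiles.
Conversely, every update fixes the pure profiles. -/

namespace StochasticMWU

variable {S S₁ S₂ : Type*} [Fintype S] [Fintype S₁] [Fintype S₂]

/-! ### Log-partition functions and Jensen's inequality. -/

section Update

/-- The logarithm of the normalizing constant of a multiplicative weights update. -/
noncomputable def logPartition (η : ℝ) (u : S → ℝ) (x : stdSimplex ℝ S) : ℝ :=
  Real.log (∑ b, x b * Real.exp (η * u b))

theorem continuous_apply_simplex (a : S) : Continuous fun x : stdSimplex ℝ S => x a :=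
  (continuous_apply a).comp continuous_subtype_val

theorem simplex_sum (x : stdSimplex ℝ S) : ∑ a, x a = 1 := x.2.2

theorem simplex_nonneg (x : stdSimplex ℝ S) (a : S) : 0 ≤ x a := x.2.1 a

theorem continuous_logPartition (η : ℝ) (u : S → ℝ) : Continuous (logPartition η u) := by
  refine Continuous.log ?_ fun x => (mwu_denom_pos η u x).ne'
  exact continuous_finsetSum _ fun b _ => (continuous_apply_simplex b).mul continuous_const

theorem mwu_apply (η : ℝ) (u : S → ℝ) (x : stdSimplex ℝ S) (a : S) :
    mwu η u x a = x a * Real.exp (η * u a) / ∑ b, x b * Real.exp (η * u b) := rfl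

theorem mwu_apply_eq_zero_iff (η : ℝ) (u : S → ℝ) (x : stdSimplex ℝ S) (a : S) :
    mwu η u x a = 0 ↔ x a = 0 := by
  simp [mwu_apply, (mwu_denom_pos η u x).ne', (Real.exp_pos _).ne']

theorem log_mwu_sub_log (η : ℝ) (u : S → ℝ) (x : stdSimplex ℝ S) {a : S} (ha : x a ≠ 0) :
    Real.log (mwu η u x a) - Real.log (x a) = η * u a - logPartition η u x := by
  rw [mwu_apply, Real.log_div (mul_ne_zero ha (Real.exp_pos _).ne') (mwu_denom_pos η u x).ne',
    Real.log_mul ha (Real.exp_pos _).ne', Real.log_exp, logPartition]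
  ring

/-- With `c` the mean payoff, this reduces Jensen's inequality and its equality case to `1 + t ≤ exp
t`. -/
theorem logPartition_sub (η : ℝ) (u : S → ℝ) (x : stdSimplex ℝ S) (c : ℝ) :
    logPartition η u x - c = Real.log (∑ a, x a * Real.exp (η * u a - c)) := by
  have h : ∑ a, x a * Real.exp (η * u a - c) = (∑ a, x a * Real.exp (η * u a)) / Real.exp c := by
    simp only [Real.exp_sub, Finset.sum_div, mul_div_assoc]
  rw [h, Real.log_div (mwu_denom_pos η u x).ne' (Real.exp_pos _).ne', Real.log_exp, logPartition]

theorem sum_mul_add_one_sub_mean (x : stdSimplex ℝ S) (t : S → ℝ) :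
    ∑ a, x a * (t a - ∑ b, x b * t b + 1) = 1 := by
  simp only [mul_add, mul_sub, Finset.sum_add_distrib, Finset.sum_sub_distrib, ← Finset.sum_mul,
    simplex_sum]
  ring

/-- Jensen's inequality for the log-partition function. -/
theorem mean_le_logPartition (η : ℝ) (u : S → ℝ) (x : stdSimplex ℝ S) :
    ∑ a, x a * (η * u a) ≤ logPartition η u x := by
  rw [← sub_nonneg, logPartition_sub]
  refine Real.log_nonneg ?_
  rw [← sum_mul_add_one_sub_mean x fun a => η * u a]
  exact Finset.sum_le_sum fun a _ =>
    mul_le_mul_of_nonneg_left (Real.add_one_le_exp _) (simplex_nonneg x a)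

/-- The equality case of Jensen's inequality for the log-partition function. -/
theorem eq_mean_of_logPartition_eq (η : ℝ) (u : S → ℝ) (x : stdSimplex ℝ S)
    (h : logPartition η u x = ∑ a, x a * (η * u a)) {a : S} (ha : x a ≠ 0) :
    η * u a = ∑ b, x b * (η * u b) := by
  by_contra hne
  have hlt : 0 < logPartition η u x - ∑ a, x a * (η * u a) := by
    rw [logPartition_sub]
    refine Real.log_pos ?_
    rw [← sum_mul_add_one_sub_mean x fun a => η * u a]
    refine Finset.sum_lt_sum (fun a _ =>
      mul_le_mul_of_nonneg_left (Real.add_one_le_exp _) (simplex_nonneg x a))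
      ⟨a, Finset.mem_univ a, ?_⟩
    exact mul_lt_mul_of_pos_left (Real.add_one_lt_exp (sub_ne_zero.2 hne))
      ((simplex_nonneg x a).lt_of_ne' ha)
  exact hlt.ne' (sub_eq_zero.2 h)

theorem exists_ne_zero (x : stdSimplex ℝ S) : ∃ a, x a ≠ 0 := by
  by_contra! h
  simpa [h] using simplex_sum x

open Classical in
theorem eq_vertex_of_subsingleton_support (x : stdSimplex ℝ S) {a : S}
    (h : ∀ b, x b ≠ 0 → b = a) : x = stdSimplex.vertex a := by
  have hz : ∀ b, b ≠ a → x b = 0 := fun b hb => by_contra fun h0 => hb (h b h0)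
  have h1 : x a = 1 := by
    rw [← simplex_sum x, Finset.sum_eq_single a (fun b _ hb => hz b hb) (by simp)]
  ext b
  by_cases hb : b = a
  · subst hb; simp [h1]
  · simp [hz b hb, hb]

/-- If the log-partition function attains the mean for an injective payoff vector, then the mixed
strategy is pure. -/
theorem exists_eq_vertex_of_logPartition_eq {η : ℝ} (hη : η ≠ 0) {u : S → ℝ}
    (hu : Function.Injective u) (x : stdSimplex ℝ S)
    (h : logPartition η u x = ∑ a, x a * (η * u a)) :
    ∃ a, ∀ b, x b ≠ 0 → b = a := by
  obtain ⟨a, ha⟩ := exists_ne_zero x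
  refine ⟨a, fun b hb => hu (mul_left_cancel₀ hη ?_)⟩
  rw [eq_mean_of_logPartition_eq η u x h ha, eq_mean_of_logPartition_eq η u x h hb]

open Classical in
theorem mwu_vertex (η : ℝ) (u : S → ℝ) (a : S) :
    mwu η u (stdSimplex.vertex a) = stdSimplex.vertex a := by
  refine eq_vertex_of_subsingleton_support _ fun b hb => ?_
  by_contra hba
  exact hb ((mwu_apply_eq_zero_iff _ _ _ _).2 (by simp [hba]))

end Update

/-! ### Vanishing mean drift under a stationary law. -/

section Drift

variable (A : Matrix S₁ S₂ ℝ) (η₁ η₂ : ℝ)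

theorem kernel_apply (x : Profile S₁ S₂) : kernel A η₁ η₂ x =
    ∑ s : S₁ × S₂, ENNReal.ofReal (playProb x s) • Measure.dirac (step A η₁ η₂ s x) := rfl

theorem playProb_nonneg (x : Profile S₁ S₂) (s : S₁ × S₂) : 0 ≤ playProb x s :=
  mul_nonneg (simplex_nonneg _ _) (simplex_nonneg _ _)

theorem sum_playProb (x : Profile S₁ S₂) : ∑ s, playProb x s = 1 := by
  simp only [playProb, Fintype.sum_prod_type, ← Finset.mul_sum, simplex_sum, mul_one]

theorem integral_kernel (x : Profile S₁ S₂) (f : Profile S₁ S₂ → ℝ) :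
    ∫ y, f y ∂(kernel A η₁ η₂ x) = ∑ s, playProb x s * f (step A η₁ η₂ s x) := by
  rw [kernel_apply, integral_finsetSum_measure]
  · refine Finset.sum_congr rfl fun s _ => ?_
    rw [integral_smul_measure, integral_dirac, ENNReal.toReal_ofReal (playProb_nonneg x s),
      smul_eq_mul]
  · exact fun s _ => (integrable_dirac (by simp)).smul_measure ENNReal.ofReal_ne_top

variable {A η₁ η₂}
variable {π : Measure (Profile S₁ S₂)} [IsProbabilityMeasure π]

theorem integral_drift_eq_zero_of_bounded (hπ : Kernel.Invariant (kernel A η₁ η₂) π)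
    {f : Profile S₁ S₂ → ℝ} (hf : Measurable f) {C : ℝ} (hC : ∀ x, |f x| ≤ C) :
    ∫ x, ∑ s, playProb x s * (f (step A η₁ η₂ s x) - f x) ∂π = 0 := by
  have hfi : Integrable f π := Integrable.of_bound hf.aestronglyMeasurable C (ae_of_all _ hC)
  have hfi' : Integrable f (π.bind (kernel A η₁ η₂)) := by rwa [hπ.def]
  have hc : ∫ x, ∫ y, f y ∂(kernel A η₁ η₂ x) ∂π = ∫ x, f x ∂π := by
    rw [Measure.comp_eq_comp_const_apply] at hfi'
    have h := Kernel.integral_comp hfi'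
    rwa [← Measure.comp_eq_comp_const_apply, hπ.def, Kernel.const_apply, eq_comm] at h
  have hi : Integrable (fun x => ∫ y, f y ∂(kernel A η₁ η₂ x)) π := by
    refine Integrable.of_bound hf.stronglyMeasurable.integral_kernel.aestronglyMeasurable C
      (ae_of_all _ fun x => ?_)
    simpa using norm_integral_le_of_norm_le_const (μ := kernel A η₁ η₂ x) (f := f) (ae_of_all _ hC)
  rw [← sub_eq_zero.2 hc, ← integral_sub hi hfi]
  refine integral_congr_ae (ae_of_all _ fun x => ?_)
  simp only [integral_kernel, mul_sub, Finset.sum_sub_distrib, ← Finset.sum_mul, sum_playProb,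
    one_mul]

/-- Under a stationary law the mean drift of a function with bounded increments vanishes, even if
the function is not integrable. -/
theorem integral_drift_eq_zero (hπ : Kernel.Invariant (kernel A η₁ η₂) π)
    {f : Profile S₁ S₂ → ℝ} (hf : Measurable f) {C : ℝ}
    (hC : ∀ s x, |f (step A η₁ η₂ s x) - f x| ≤ C) :
    ∫ x, ∑ s, playProb x s * (f (step A η₁ η₂ s x) - f x) ∂π = 0 := by
  -- Truncation to `[-n, n]` is 1-Lipschitz, so the increments of every `g n` keep the bound `C`,
  -- which permits dominated convergence.
  let g : ℕ → Profile S₁ S₂ → ℝ := fun n x => max (-(n : ℝ)) (min n (f x))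
  have hg : ∀ n, Measurable (g n) := fun n => measurable_const.max (measurable_const.min hf)
  have hgb : ∀ n x, |g n x| ≤ n := fun n x => by
    have hn : (0 : ℝ) ≤ n := n.cast_nonneg
    exact abs_le.2 ⟨le_max_left _ _, max_le (by linarith) (min_le_left _ _)⟩
  have hgd : ∀ n x y, |g n x - g n y| ≤ |f x - f y| := fun n x y => by
    refine (abs_max_sub_max_le_max _ _ _ _).trans ?_
    rw [sub_self, abs_zero, max_eq_right (abs_nonneg _)]
    refine (abs_min_sub_min_le_max _ _ _ _).trans ?_
    rw [sub_self, abs_zero, max_eq_right (abs_nonneg _)]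
  have hgl : ∀ x, Filter.Tendsto (fun n => g n x) Filter.atTop (nhds (f x)) := fun x => by
    refine tendsto_const_nhds.congr' ?_
    obtain ⟨N, hN⟩ := exists_nat_ge |f x|
    filter_upwards [Filter.eventually_ge_atTop N] with n hn
    have hn' : |f x| ≤ n := hN.trans (by exact_mod_cast hn)
    obtain ⟨h1, h2⟩ := abs_le.1 hn'
    simp only [g]
    rw [min_eq_right h2, max_eq_right h1]
  refine tendsto_nhds_unique (tendsto_integral_of_dominated_convergence (fun _ => C)
    (F := fun n x => ∑ s, playProb x s * (g n (step A η₁ η₂ s x) - g n x)) ?_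
    (integrable_const C) ?_ ?_) ?_
  · exact fun n => (Finset.measurable_sum _ fun s _ => (measurable_playProb s).mul
      (((hg n).comp (measurable_step A η₁ η₂ s)).sub (hg n))).aestronglyMeasurable
  · refine fun n => ae_of_all _ fun x => ?_
    refine (Finset.abs_sum_le_sum_abs _ _).trans ?_
    rw [← one_mul C, ← sum_playProb x, Finset.sum_mul]
    refine Finset.sum_le_sum fun s _ => ?_
    rw [abs_mul, abs_of_nonneg (playProb_nonneg x s)]
    exact mul_le_mul_of_nonneg_left ((hgd n _ _).trans (hC s x)) (playProb_nonneg x s)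
  · exact ae_of_all _ fun x => tendsto_finsetSum _ fun s _ =>
      ((hgl _).sub (hgl _)).const_mul _
  · refine tendsto_const_nhds.congr fun n => ?_
    exact (integral_drift_eq_zero_of_bounded hπ (hg n) (hgb n)).symm

/-- The vanishing of the mean drift, localized to a set that the chain neither enters nor leaves. -/
theorem setIntegral_drift_eq_zero (hπ : Kernel.Invariant (kernel A η₁ η₂) π)
    {F : Set (Profile S₁ S₂)} (hF : MeasurableSet F)
    (hstep : ∀ s x, step A η₁ η₂ s x ∈ F ↔ x ∈ F)
    {f : Profile S₁ S₂ → ℝ} (hf : Measurable f) {d : S₁ × S₂ → Profile S₁ S₂ → ℝ}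
    (hd : ∀ s, Continuous (d s))
    (hfd : ∀ s, ∀ x ∈ F, f (step A η₁ η₂ s x) - f x = d s x) :
    ∫ x in F, ∑ s, playProb x s * d s x ∂π = 0 := by
  have hinc : ∀ s x, F.indicator f (step A η₁ η₂ s x) - F.indicator f x =
      F.indicator (d s) x := fun s x => by
    by_cases hx : x ∈ F
    · simp [hx, (hstep s x).2 hx, hfd s x hx]
    · simp [hx, (hstep s x).not.2 hx]
  -- The space of profiles is compact.
  have hb : ∀ s, ∃ C, ∀ x, |d s x| ≤ C := fun s => by
    obtain ⟨C, hC⟩ := (isCompact_range (hd s)).isBounded.exists_norm_le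
    exact ⟨C, fun x => hC _ ⟨x, rfl⟩⟩
  choose C hC using hb
  have hC' : ∀ s x, |F.indicator f (step A η₁ η₂ s x) - F.indicator f x| ≤ ∑ s, |C s| :=
    fun s x => by
      rw [hinc]
      refine le_trans ?_ (Finset.single_le_sum (fun s _ => abs_nonneg (C s)) (Finset.mem_univ s))
      by_cases hx : x ∈ F
      · simpa [hx] using (hC s x).trans (le_abs_self _)
      · simp [hx]
  rw [← integral_indicator hF, ← integral_drift_eq_zero hπ (hf.indicator hF) hC']
  refine integral_congr_ae (ae_of_all _ fun x => ?_)
  simp only [hinc]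
  by_cases hx : x ∈ F <;> simp [hx]

end Drift

/-! ### Equal payoffs and zero excess on each face. -/

section Face

/-- The relatively open face of the profiles with the given supports. -/
def face (T : Set S₁ × Set S₂) : Set (Profile S₁ S₂) :=
  {x | (∀ a, x.1 a ≠ 0 ↔ a ∈ T.1) ∧ ∀ b, x.2 b ≠ 0 ↔ b ∈ T.2}

theorem continuous_fst_apply (a : S₁) : Continuous fun x : Profile S₁ S₂ => x.1 a :=
  (continuous_apply_simplex a).comp continuous_fst

theorem continuous_snd_apply (b : S₂) : Continuous fun x : Profile S₁ S₂ => x.2 b :=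
  (continuous_apply_simplex b).comp continuous_snd

theorem measurableSet_face (T : Set S₁ × Set S₂) : MeasurableSet (face T) := by
  have h1 : ∀ a, MeasurableSet {x : Profile S₁ S₂ | x.1 a ≠ 0} := fun a =>
    (isOpen_ne_fun (continuous_fst_apply a) continuous_const).measurableSet
  have h2 : ∀ b, MeasurableSet {x : Profile S₁ S₂ | x.2 b ≠ 0} := fun b =>
    (isOpen_ne_fun (continuous_snd_apply b) continuous_const).measurableSet
  refine MeasurableSet.inter ?_ ?_
  · exact (measurableSet_setOfPred.2 (Measurable.forall fun a =>
      (measurableSet_setOfPred.1 (h1 a)).iff measurable_const))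
  · exact (measurableSet_setOfPred.2 (Measurable.forall fun b =>
      (measurableSet_setOfPred.1 (h2 b)).iff measurable_const))

variable {A : Matrix S₁ S₂ ℝ} {η₁ η₂ : ℝ}

theorem step_mem_face_iff (T : Set S₁ × Set S₂) (s : S₁ × S₂) (x : Profile S₁ S₂) :
    step A η₁ η₂ s x ∈ face T ↔ x ∈ face T := by
  simp only [face, step, Set.mem_ofPred_eq, ne_eq, mwu_apply_eq_zero_iff]

variable {π : Measure (Profile S₁ S₂)} [IsProbabilityMeasure π]

theorem integrable_of_continuous {f : Profile S₁ S₂ → ℝ} (hf : Continuous f)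
    (F : Set (Profile S₁ S₂)) : Integrable f (π.restrict F) :=
  hf.integrable_of_hasCompactSupport (HasCompactSupport.of_compactSpace f)

/-- Every action in the support of the first agent's strategies has the same mean payoff. -/
theorem mean_payoff_fst (hπ : Kernel.Invariant (kernel A η₁ η₂) π) (T : Set S₁ × Set S₂)
    {a : S₁} (ha : a ∈ T.1) :
    ∑ b, η₁ * A a b * ∫ x in face T, x.2 b ∂π =
      ∫ x in face T, ∑ b, x.2 b * logPartition η₁ (fun a => A a b) x.1 ∂π := by
  have hL : ∀ b, Continuous fun x : Profile S₁ S₂ => logPartition η₁ (fun a => A a b) x.1 :=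
    fun b => (continuous_logPartition _ _).comp continuous_fst
  -- Since `a ∈ T.1`, the coordinate is nonzero on the face and the convention `log 0 = 0` plays no
  -- role there.
  have h := setIntegral_drift_eq_zero hπ (measurableSet_face T) (step_mem_face_iff T)
    (f := fun x => Real.log (x.1 a)) (Real.measurable_log.comp (continuous_fst_apply a).measurable)
    (d := fun s x => η₁ * A a s.2 - logPartition η₁ (fun a => A a s.2) x.1)
    (fun s => continuous_const.sub (hL s.2))
    (fun s x hx => log_mwu_sub_log η₁ (fun a => A a s.2) x.1 ((hx.1 a).2 ha))
  have hsum : ∀ x : Profile S₁ S₂, ∑ s : S₁ × S₂, playProb x s *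
      (η₁ * A a s.2 - logPartition η₁ (fun a => A a s.2) x.1) =
      ∑ b, x.2 b * (η₁ * A a b) - ∑ b, x.2 b * logPartition η₁ (fun a => A a b) x.1 := fun x => by
    simp only [playProb, Fintype.sum_prod_type, mul_assoc, ← Finset.mul_sum, ← Finset.sum_mul,
      simplex_sum, one_mul, mul_sub, Finset.sum_sub_distrib]
  have hI : ∀ b, Integrable (fun x : Profile S₁ S₂ => x.2 b * (η₁ * A a b))
      (π.restrict (face T)) := fun b =>
    integrable_of_continuous ((continuous_snd_apply b).mul continuous_const) _
  have hJ : ∀ b, Integrable (fun x : Profile S₁ S₂ =>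
      x.2 b * logPartition η₁ (fun a => A a b) x.1) (π.restrict (face T)) := fun b =>
    integrable_of_continuous ((continuous_snd_apply b).mul (hL b)) _
  simp only [hsum] at h
  rw [integral_sub (integrable_finsetSum _ fun b _ => hI b)
    (integrable_finsetSum _ fun b _ => hJ b), sub_eq_zero] at h
  rw [← h, integral_finsetSum _ fun b _ => hI b]
  refine Finset.sum_congr rfl fun b _ => ?_
  rw [integral_mul_const, mul_comm]

/-- Every action in the support of the second agent's strategies has the same mean payoff. -/
theorem mean_payoff_snd (hπ : Kernel.Invariant (kernel A η₁ η₂) π) (T : Set S₁ × Set S₂)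
    {b : S₂} (hb : b ∈ T.2) :
    ∑ a, η₂ * (-A.transpose) b a * ∫ x in face T, x.1 a ∂π =
      ∫ x in face T, ∑ a, x.1 a * logPartition η₂ (fun b => (-A.transpose) b a) x.2 ∂π := by
  have hL : ∀ a, Continuous fun x : Profile S₁ S₂ =>
      logPartition η₂ (fun b => (-A.transpose) b a) x.2 :=
    fun a => (continuous_logPartition _ _).comp continuous_snd
  have h := setIntegral_drift_eq_zero hπ (measurableSet_face T) (step_mem_face_iff T)
    (f := fun x => Real.log (x.2 b)) (Real.measurable_log.comp (continuous_snd_apply b).measurable)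
    (d := fun s x => η₂ * (-A.transpose) b s.1 -
      logPartition η₂ (fun b => (-A.transpose) b s.1) x.2)
    (fun s => continuous_const.sub (hL s.1))
    (fun s x hx => log_mwu_sub_log η₂ (fun b => (-A.transpose) b s.1) x.2 ((hx.2 b).2 hb))
  have hsum : ∀ x : Profile S₁ S₂, ∑ s : S₁ × S₂, playProb x s *
      (η₂ * (-A.transpose) b s.1 - logPartition η₂ (fun b => (-A.transpose) b s.1) x.2) =
      ∑ a, x.1 a * (η₂ * (-A.transpose) b a) -
        ∑ a, x.1 a * logPartition η₂ (fun b => (-A.transpose) b a) x.2 := fun x => by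
    simp only [playProb, Fintype.sum_prod_type, mul_right_comm (x.1 _) (x.2 _), ← Finset.mul_sum,
      simplex_sum, mul_one, mul_sub, Finset.sum_sub_distrib]
  have hI : ∀ a, Integrable (fun x : Profile S₁ S₂ => x.1 a * (η₂ * (-A.transpose) b a))
      (π.restrict (face T)) := fun a =>
    integrable_of_continuous ((continuous_fst_apply a).mul continuous_const) _
  have hJ : ∀ a, Integrable (fun x : Profile S₁ S₂ =>
      x.1 a * logPartition η₂ (fun b => (-A.transpose) b a) x.2) (π.restrict (face T)) := fun a =>
    integrable_of_continuous ((continuous_fst_apply a).mul (hL a)) _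
  simp only [hsum] at h
  rw [integral_sub (integrable_finsetSum _ fun a _ => hI a)
    (integrable_finsetSum _ fun a _ => hJ a), sub_eq_zero] at h
  rw [← h, integral_finsetSum _ fun a _ => hI a]
  refine Finset.sum_congr rfl fun a _ => ?_
  rw [integral_mul_const, mul_comm]

/-- The total excess, over the expected payoffs, of the normalized log-partition functions of both
agents. The expected payoffs cancel because the game has zero sum. -/
noncomputable def excess (A : Matrix S₁ S₂ ℝ) (η₁ η₂ : ℝ) (x : Profile S₁ S₂) : ℝ :=
  η₂ * ∑ b, x.2 b * logPartition η₁ (fun a => A a b) x.1 +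
    η₁ * ∑ a, x.1 a * logPartition η₂ (fun b => (-A.transpose) b a) x.2

theorem continuous_excess : Continuous (excess A η₁ η₂) := by
  refine (continuous_const.mul ?_).add (continuous_const.mul ?_)
  · exact continuous_finsetSum _ fun b _ => (continuous_snd_apply b).mul
      ((continuous_logPartition _ _).comp continuous_fst)
  · exact continuous_finsetSum _ fun a _ => (continuous_fst_apply a).mul
      ((continuous_logPartition _ _).comp continuous_snd)

/-- The crossed weights `η₂` and `η₁` give both expected payoffs the factor `η₁ * η₂` with opposite
signs, so subtracting them costs nothing. -/
theorem excess_eq (x : Profile S₁ S₂) : excess A η₁ η₂ x =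
    η₂ * ∑ b, x.2 b * (logPartition η₁ (fun a => A a b) x.1 - ∑ a, x.1 a * (η₁ * A a b)) +
    η₁ * ∑ a, x.1 a * (logPartition η₂ (fun b => (-A.transpose) b a) x.2 -
      ∑ b, x.2 b * (η₂ * (-A.transpose) b a)) := by
  have h : η₂ * ∑ b, x.2 b * ∑ a, x.1 a * (η₁ * A a b) +
      η₁ * ∑ a, x.1 a * ∑ b, x.2 b * (η₂ * (-A.transpose) b a) = 0 := by
    simp only [Finset.mul_sum]
    rw [Finset.sum_comm, ← Finset.sum_add_distrib]
    refine Finset.sum_eq_zero fun a _ => ?_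
    rw [← Finset.sum_add_distrib]
    refine Finset.sum_eq_zero fun b _ => ?_
    simp only [Matrix.neg_apply, Matrix.transpose_apply]
    ring
  simp only [mul_sub (x.1 _), mul_sub (x.2 _), Finset.sum_sub_distrib]
  rw [excess]
  linear_combination h

theorem excess_nonneg (hη₁ : 0 < η₁) (hη₂ : 0 < η₂) (x : Profile S₁ S₂) :
    0 ≤ excess A η₁ η₂ x := by
  rw [excess_eq]
  refine add_nonneg (mul_nonneg hη₂.le ?_) (mul_nonneg hη₁.le ?_)
  · exact Finset.sum_nonneg fun b _ => mul_nonneg (simplex_nonneg _ _)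
      (sub_nonneg.2 (mean_le_logPartition _ _ _))
  · exact Finset.sum_nonneg fun a _ => mul_nonneg (simplex_nonneg _ _)
      (sub_nonneg.2 (mean_le_logPartition _ _ _))

theorem mem_pureProfiles_of_excess_eq_zero
    (hA : Function.Injective fun s : S₁ × S₂ => A s.1 s.2) (hη₁ : 0 < η₁) (hη₂ : 0 < η₂)
    {x : Profile S₁ S₂} (hx : excess A η₁ η₂ x = 0) : x ∈ pureProfiles S₁ S₂ := by
  have h1 : ∀ b ∈ Finset.univ, 0 ≤ x.2 b * (logPartition η₁ (fun a => A a b) x.1 -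
      ∑ a, x.1 a * (η₁ * A a b)) := fun b _ =>
    mul_nonneg (simplex_nonneg _ _) (sub_nonneg.2 (mean_le_logPartition _ _ _))
  have h2 : ∀ a ∈ Finset.univ, 0 ≤ x.1 a * (logPartition η₂ (fun b => (-A.transpose) b a) x.2 -
      ∑ b, x.2 b * (η₂ * (-A.transpose) b a)) := fun a _ =>
    mul_nonneg (simplex_nonneg _ _) (sub_nonneg.2 (mean_le_logPartition _ _ _))
  rw [excess_eq, add_eq_zero_iff_of_nonneg (mul_nonneg hη₂.le (Finset.sum_nonneg h1))
    (mul_nonneg hη₁.le (Finset.sum_nonneg h2)), mul_eq_zero, mul_eq_zero,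
    or_iff_right hη₁.ne', or_iff_right hη₂.ne', Finset.sum_eq_zero_iff_of_nonneg h1,
    Finset.sum_eq_zero_iff_of_nonneg h2] at hx
  -- One opposing action of positive weight suffices: its Jensen gap is zero, and the entries in its
  -- row or column are distinct.
  obtain ⟨a₀, ha₀⟩ := exists_ne_zero x.1
  obtain ⟨b₀, hb₀⟩ := exists_ne_zero x.2
  obtain ⟨a, ha⟩ := exists_eq_vertex_of_logPartition_eq hη₁.ne' (u := fun a => A a b₀)
    (fun a a' h => congrArg Prod.fst (hA (a₁ := (a, b₀)) (a₂ := (a', b₀)) h)) x.1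
    (sub_eq_zero.1 ((mul_eq_zero.1 (hx.1 b₀ (Finset.mem_univ _))).resolve_left hb₀))
  obtain ⟨b, hb⟩ := exists_eq_vertex_of_logPartition_eq hη₂.ne'
    (u := fun b => (-A.transpose) b a₀)
    (fun b b' h => congrArg Prod.snd (hA (a₁ := (a₀, b)) (a₂ := (a₀, b')) (neg_injective h))) x.2
    (sub_eq_zero.1 ((mul_eq_zero.1 (hx.2 a₀ (Finset.mem_univ _))).resolve_left ha₀))
  exact ⟨(a, b), Prod.ext (eq_vertex_of_subsingleton_support _ ha).symm
    (eq_vertex_of_subsingleton_support _ hb).symm⟩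

/-- The mean strategies on a face form an equilibrium of the corresponding subgame, so that the
mean excess vanishes. -/
theorem setIntegral_excess_eq_zero (hπ : Kernel.Invariant (kernel A η₁ η₂) π)
    (T : Set S₁ × Set S₂) : ∫ x in face T, excess A η₁ η₂ x ∂π = 0 := by
  -- The mean strategies `p` and `q` are left unnormalized, with total mass `m`, which may be zero.
  set p : S₁ → ℝ := fun a => ∫ x in face T, x.1 a ∂π with hp
  set q : S₂ → ℝ := fun b => ∫ x in face T, x.2 b ∂π with hq
  set u : ℝ := ∫ x in face T, ∑ b, x.2 b * logPartition η₁ (fun a => A a b) x.1 ∂π with hu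
  set w : ℝ := ∫ x in face T, ∑ a, x.1 a * logPartition η₂ (fun b => (-A.transpose) b a) x.2 ∂π
    with hw
  set m : ℝ := π.real (face T) with hm
  have hp_sum : ∑ a, p a = m := by
    rw [hp, ← integral_finsetSum _ fun a _ => integrable_of_continuous (continuous_fst_apply a) _]
    simp [hm]
  have hq_sum : ∑ b, q b = m := by
    rw [hq, ← integral_finsetSum _ fun b _ => integrable_of_continuous (continuous_snd_apply b) _]
    simp [hm]
  have hp_supp : ∀ a, a ∉ T.1 → p a = 0 := fun a ha =>
    setIntegral_eq_zero_of_forall_eq_zero fun x hx => by_contra fun h => ha ((hx.1 a).1 h)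
  have hq_supp : ∀ b, b ∉ T.2 → q b = 0 := fun b hb =>
    setIntegral_eq_zero_of_forall_eq_zero fun x hx => by_contra fun h => hb ((hx.2 b).1 h)
  have hu' : m * u = ∑ a, p a * ∑ b, η₁ * A a b * q b := by
    rw [← hp_sum, Finset.sum_mul]
    refine Finset.sum_congr rfl fun a _ => ?_
    by_cases ha : a ∈ T.1
    · rw [hu, ← mean_payoff_fst hπ T ha]
    · rw [hp_supp a ha, zero_mul, zero_mul]
  have hw' : m * w = ∑ b, q b * ∑ a, η₂ * (-A.transpose) b a * p a := by
    rw [← hq_sum, Finset.sum_mul]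
    refine Finset.sum_congr rfl fun b _ => ?_
    by_cases hb : b ∈ T.2
    · rw [hw, ← mean_payoff_snd hπ T hb]
    · rw [hq_supp b hb, zero_mul, zero_mul]
  have hsum : m * (η₂ * u + η₁ * w) = 0 := by
    have : m * (η₂ * u + η₁ * w) = η₂ * (m * u) + η₁ * (m * w) := by ring
    rw [this, hu', hw']
    simp only [Finset.mul_sum]
    rw [Finset.sum_comm, ← Finset.sum_add_distrib]
    refine Finset.sum_eq_zero fun b _ => ?_
    rw [← Finset.sum_add_distrib]
    refine Finset.sum_eq_zero fun a _ => ?_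
    simp only [Matrix.neg_apply, Matrix.transpose_apply]
    ring
  rcases mul_eq_zero.1 hsum with h0 | h0
  · exact setIntegral_measure_zero _ ((measureReal_eq_zero_iff).1 h0)
  · rw [← h0, hu, hw, ← integral_const_mul, ← integral_const_mul, ← integral_add]
    · rfl
    · exact integrable_of_continuous (continuous_const.mul (continuous_finsetSum _ fun b _ =>
        (continuous_snd_apply b).mul ((continuous_logPartition _ _).comp continuous_fst))) _
    · exact integrable_of_continuous (continuous_const.mul (continuous_finsetSum _ fun a _ =>
        (continuous_fst_apply a).mul ((continuous_logPartition _ _).comp continuous_snd))) _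

theorem measure_compl_pureProfiles_eq_zero
    (hA : Function.Injective fun s : S₁ × S₂ => A s.1 s.2) (hη₁ : 0 < η₁) (hη₂ : 0 < η₂)
    (hπ : Kernel.Invariant (kernel A η₁ η₂) π) : π (pureProfiles S₁ S₂)ᶜ = 0 := by
  have hface : ∀ T : Set S₁ × Set S₂, ∀ᵐ x ∂π, x ∈ face T → x ∈ pureProfiles S₁ S₂ := fun T => by
    have h := (integral_eq_zero_iff_of_nonneg (excess_nonneg hη₁ hη₂)
      (integrable_of_continuous continuous_excess _)).1 (setIntegral_excess_eq_zero hπ T)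
    filter_upwards [(ae_restrict_iff' (measurableSet_face T)).1 h] with x hx hxT
    exact mem_pureProfiles_of_excess_eq_zero hA hη₁ hη₂ (hx hxT)
  -- There are finitely many faces, and each profile lies on the face of its own supports.
  have hall := ae_all_iff.2 hface
  refine measure_mono_null (fun x hx => ?_) (ae_iff.1 hall)
  intro h
  exact hx (h ({a | x.1 a ≠ 0}, {b | x.2 b ≠ 0}) ⟨fun _ => Iff.rfl, fun _ => Iff.rfl⟩)

end Face

/-! ### Pure profiles are absorbing. -/

section Pure

variable {A : Matrix S₁ S₂ ℝ} {η₁ η₂ : ℝ}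

theorem kernel_apply_of_mem_pureProfiles {x : Profile S₁ S₂} (hx : x ∈ pureProfiles S₁ S₂) :
    kernel A η₁ η₂ x = Measure.dirac x := by
  obtain ⟨s, rfl⟩ := hx
  simp only [kernel_apply, step, mwu_vertex, ← Finset.sum_smul]
  rw [← ENNReal.ofReal_sum_of_nonneg fun s _ => playProb_nonneg _ s, sum_playProb,
    ENNReal.ofReal_one, one_smul]

theorem invariant_of_measure_compl_pureProfiles_eq_zero
    {π : Measure (Profile S₁ S₂)} (h : π (pureProfiles S₁ S₂)ᶜ = 0) :
    Kernel.Invariant (kernel A η₁ η₂) π := by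
  rw [Kernel.Invariant, Measure.bind_congr_right (g := Measure.dirac), Measure.bind_dirac]
  filter_upwards [show ∀ᵐ x ∂π, x ∈ pureProfiles S₁ S₂ from h] with x hx
  exact kernel_apply_of_mem_pureProfiles hx

end Pure

end StochasticMWU

theorem mainTheorem2 {S₁ S₂ : Type*} [Fintype S₁] [Fintype S₂]
    (A : Matrix S₁ S₂ ℝ) (hA : Function.Injective fun s : S₁ × S₂ => A s.1 s.2)
    (η₁ η₂ : ℝ) (hη₁ : 0 < η₁) (hη₂ : 0 < η₂)
    (π : Measure (StochasticMWU.Profile S₁ S₂)) [IsProbabilityMeasure π] :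
    Kernel.Invariant (StochasticMWU.kernel A η₁ η₂) π ↔
      π (StochasticMWU.pureProfiles S₁ S₂)ᶜ = 0 := by
  exact ⟨StochasticMWU.measure_compl_pureProfiles_eq_zero hA hη₁ hη₂,
    StochasticMWU.invariant_of_measure_compl_pureProfiles_eq_zero⟩
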